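/- Let $(\overline M,\bar g,J_1,J_2,J_3)$ be a hyper-K\"ahler manifold, with Levi-Civita connection $\overline\nabla$: the $J_i$ are smooth $\bar g$-orthogonal almost complex structures which satisfy the quaternion relations and are parallel with respect to $\overline\nabla$. Let $M$ be an (immersed) submanifold of $\overline M$ with the induced metric $g$ and its Levi-Civita connection $\nabla$. Let $b$ be the second fundamental form, $b(X,Y)=(\overline\nabla_XY)^{\perp}$, the normal component of $\overline\nabla_XY$, and write $b(X)=b(X,\cdot)$. Suppose that $M$ is a QR-submanifold of hypersurface type: there is a smooth subbundle $\nu$ of the normal bundle such that, if $\nu^\perp$ is its orthogonal complement in the normal bundle, then $J_i\nu\subset\nu$ and $J_i\nu^\perp\subset TM$ for $i=1,2,3$, and $\nu^\perp$ has rank $1$. Let $n$ be a smooth unit section of $\nu^\perp$ over an open set $U\subset M$, and put $\xi_i=J_in$. Then, on $U$, for $i=1,2,3$: (1) $\xi_i$ is a smooth vector field on $M$, tangent to $M$, and for every tangent vector $u$ of $M$ $$\nabla_u\xi_i=J_i(\overline\nabla_un)-b(\xi_i,u).$$ (2) If $\xi_\alpha$ is a smooth vector field on $U$, tangent to $M$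 and orthogonal to $\xi_i$ (for instance a member of a local frame $\xi_1,\xi_2,\xi_3,\xi_4,\dots$ of $TM$ which is orthogonal to $\xi_1,\xi_2,\xi_3$), then $J_i\xi_\alpha$ is a smooth vector field tangent to $M$, and for every tangent vector $u$ of $M$ $$(\nabla_uJ_i)(\xi_\alpha)=J_i\,b(\xi_\alpha,u)-b(J_i\xi_\alpha,u),$$ where $(\nabla_uJ_i)(\xi_\alpha):=\nabla_u(J_i\xi_\alpha)-J_i(\nabla_u\xi_\alpha)$, an identity between vectors tangent to $\overline M$. -/

import Mathlib

open Bundle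
open scoped Manifold ContDiff

noncomputable section

namespace QRSubmanifold

/-! ### Ambient geometry: Levi-Civita connection, hyper-Kähler structures -/

section Ambient

variable {F : Type*} [NormedAddCommGroup F] [NormedSpace ℝ F] [FiniteDimensional ℝ F]
  {N : Type*} [TopologicalSpace N] [ChartedSpace F N] [IsManifold 𝓘(ℝ, F) ∞ N]
  [RiemannianBundle (fun p : N ↦ TangentSpace 𝓘(ℝ, F) p)]
  [IsContMDiffRiemannianBundle 𝓘(ℝ, F) ∞ F (fun p : N ↦ TangentSpace 𝓘(ℝ, F) p)]

/-- `cov` is a Levi-Civita connection of the Riemannian manifold `N`: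
it is compatible with the metric and torsion-free.
(In Mathlib's notation `cov Y p u` is the covariant derivative of `Y` at `p` in direction `u`.) -/
structure IsLeviCivita
    (cov : CovariantDerivative 𝓘(ℝ, F) F (fun p : N ↦ TangentSpace 𝓘(ℝ, F) p)) : Prop where
  metric : CovariantDerivative.IsMetricCompatible (V := fun p : N ↦ TangentSpace 𝓘(ℝ, F) p) cov
  torsion_free : cov.torsion = 0

/-- `(g, J 0, J 1, J 2)` is a hyper-Kähler structure on the Riemannian manifold `N` with
Levi-Civita connection `cov`: the `J i` are smooth almost complex structures satisfying the
quaternion relations, each of them is orthogonal, and each of them is parallel.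
The quaternion relations force the dimension to be a multiple of four. -/
structure IsHyperKahler
    (cov : CovariantDerivative 𝓘(ℝ, F) F (fun p : N ↦ TangentSpace 𝓘(ℝ, F) p))
    (J : Fin 3 → (p : N) → TangentSpace 𝓘(ℝ, F) p →L[ℝ] TangentSpace 𝓘(ℝ, F) p) : Prop where
  leviCivita : IsLeviCivita cov
  smooth : ∀ i, ContMDiff 𝓘(ℝ, F) (𝓘(ℝ, F).prod 𝓘(ℝ, F →L[ℝ] F)) ∞
    (fun p : N ↦ Bundle.TotalSpace.mk' (F →L[ℝ] F)
      (E := fun p : N ↦ TangentSpace 𝓘(ℝ, F) p →L[ℝ] TangentSpace 𝓘(ℝ, F) p) p (J i p))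
  sq : ∀ i p v, J i p (J i p v) = -v
  mul : ∀ p v, J 0 p (J 1 p v) = J 2 p v
  orthogonal : ∀ i p v w, inner ℝ (J i p v) (J i p w) = inner ℝ v w
  parallel : ∀ i (Y : (p : N) → TangentSpace 𝓘(ℝ, F) p) (p : N),
    MDifferentiableAt 𝓘(ℝ, F) (𝓘(ℝ, F).prod 𝓘(ℝ, F))
      (fun q ↦ (⟨q, Y q⟩ : TangentBundle 𝓘(ℝ, F) N)) p →
    ∀ u, cov (fun q ↦ J i q (Y q)) p u = J i p (cov Y p u)

end Ambient

/-! ### Submanifolds -/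

section Submanifold

variable {E : Type*} [NormedAddCommGroup E] [NormedSpace ℝ E] [FiniteDimensional ℝ E]
  {M : Type*} [TopologicalSpace M] [ChartedSpace E M] [IsManifold 𝓘(ℝ, E) ∞ M]
  {F : Type*} [NormedAddCommGroup F] [NormedSpace ℝ F] [FiniteDimensional ℝ F]
  {N : Type*} [TopologicalSpace N] [ChartedSpace F N] [IsManifold 𝓘(ℝ, F) ∞ N]

/-- `X` is a smooth vector field on the subset `U` of `M`. -/
def SmoothFieldOn (X : (x : M) → TangentSpace 𝓘(ℝ, E) x) (U : Set M) : Prop :=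
  ContMDiffOn 𝓘(ℝ, E) (𝓘(ℝ, E).prod 𝓘(ℝ, E)) ∞
    (fun x ↦ (⟨x, X x⟩ : TangentBundle 𝓘(ℝ, E) M)) U

/-- `V` is a smooth section over `U` of the pullback bundle `f^* TN`, that is, a smooth vector
field of `N` along `f`. -/
def SmoothAlongOn (f : M → N) (V : (x : M) → TangentSpace 𝓘(ℝ, F) (f x)) (U : Set M) : Prop :=
  ContMDiffOn 𝓘(ℝ, E) (𝓘(ℝ, F).prod 𝓘(ℝ, F)) ∞
    (fun x ↦ (⟨f x, V x⟩ : TangentBundle 𝓘(ℝ, F) N)) U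

/-- The differential of `f` at `x`. -/
def df (f : M → N) (x : M) : TangentSpace 𝓘(ℝ, E) x →L[ℝ] TangentSpace 𝓘(ℝ, F) (f x) :=
  mfderiv 𝓘(ℝ, E) 𝓘(ℝ, F) f x

/-- The tangent space of the submanifold at `x`, as a subspace of the tangent space of `N`. -/
def tangentImage (f : M → N) (x : M) : Submodule ℝ (TangentSpace 𝓘(ℝ, F) (f x)) :=
  LinearMap.range (df (E := E) f x).toLinearMap

/-- For a vector `w` which is tangent to the submanifold at `x`, the corresponding vector of the
tangent space of `M` (the preimage of `w` under the differential of `f`). -/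
def toTangent (f : M → N) (x : M) (w : TangentSpace 𝓘(ℝ, F) (f x)) : TangentSpace 𝓘(ℝ, E) x :=
  Function.invFun (df (E := E) f x) w

/-- The ambient covariant derivative at `x`, in direction `u`, of a vector field `V` along `f`
(the pullback connection on `f^* TN`). In the local frame of `TN` around `f x` given by the
trivialization at `f x`, write `V = ∑ Vᵃ eₐ`; then the value is
`∑ dVᵃ(u) eₐ + ∑ Vᵃ(x) ∇_{df(u)} eₐ`. Here `FiberBundle.extend F (V x)` is
the local vector field `∑ Vᵃ(x) eₐ` with constant coefficients. -/
def covAlong (cov : CovariantDerivative 𝓘(ℝ, F) F (fun p : N ↦ TangentSpace 𝓘(ℝ, F) p))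
    (f : M → N) (V : (x : M) → TangentSpace 𝓘(ℝ, F) (f x)) (x : M)
    (u : TangentSpace 𝓘(ℝ, E) x) : TangentSpace 𝓘(ℝ, F) (f x) :=
  let t := trivializationAt F (fun p : N ↦ TangentSpace 𝓘(ℝ, F) p) (f x)
  let coeff : M → F := fun y ↦ (t (⟨f y, V y⟩ : TangentBundle 𝓘(ℝ, F) N)).2
  let dcoeff : F := mfderiv 𝓘(ℝ, E) 𝓘(ℝ, F) coeff x u
  t.symm (f x) dcoeff + cov (FiberBundle.extend F (V x)) (f x) (df f x u)

variable [RiemannianBundle (fun x : M ↦ TangentSpace 𝓘(ℝ, E) x)]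
  [RiemannianBundle (fun p : N ↦ TangentSpace 𝓘(ℝ, F) p)]

/-- The metric of `M` is induced by the metric of `N` through `f`. -/
def IsInducedMetric (f : M → N) : Prop :=
  ∀ (x : M) (u v : TangentSpace 𝓘(ℝ, E) x),
    inner ℝ u v = inner ℝ (df (F := F) f x u) (df (F := F) f x v)

/-- The normal space of the submanifold at `x`. -/
def normalSpace (f : M → N) (x : M) : Submodule ℝ (TangentSpace 𝓘(ℝ, F) (f x)) :=
  (tangentImage (E := E) f x)ᗮ

/-- The normal component at `x` of a tangent vector of `N`. -/
def normalPart (f : M → N) (x : M) (w : TangentSpace 𝓘(ℝ, F) (f x)) :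
    TangentSpace 𝓘(ℝ, F) (f x) :=
  haveI : FiniteDimensional ℝ (TangentSpace 𝓘(ℝ, F) (f x)) :=
    inferInstanceAs (FiniteDimensional ℝ F)
  (normalSpace (E := E) f x).starProjection w

/-- The second fundamental form `b(u, v)` of the submanifold at `x`: the normal component of the
ambient covariant derivative, in direction `u`, of a local tangent vector field of `M` which
extends `v`. -/
def secondFundamentalForm
    (cov : CovariantDerivative 𝓘(ℝ, F) F (fun p : N ↦ TangentSpace 𝓘(ℝ, F) p))
    (f : M → N) (x : M) (u v : TangentSpace 𝓘(ℝ, E) x) : TangentSpace 𝓘(ℝ, F) (f x) :=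
  normalPart (E := E) f x
    (covAlong cov f (fun y ↦ df f y (FiberBundle.extend E v y)) x u)

/-- `ν` is a smooth vector subbundle of `f^* TN`: locally it has a smooth frame. -/
def IsSmoothSubbundle (f : M → N)
    (ν : (x : M) → Submodule ℝ (TangentSpace 𝓘(ℝ, F) (f x))) : Prop :=
  ∀ x₀ : M, ∃ U : Set M, IsOpen U ∧ x₀ ∈ U ∧
    ∃ (k : ℕ) (s : Fin k → (x : M) → TangentSpace 𝓘(ℝ, F) (f x)),
      (∀ a, SmoothAlongOn (E := E) f (s a) U) ∧
      ∀ x ∈ U, LinearIndependent ℝ (fun a ↦ s a x) ∧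
        Submodule.span ℝ (Set.range fun a ↦ s a x) = ν x

/-- The orthogonal complement `ν^⊥` of `ν` in the normal bundle, at `x`. -/
def normalCompl (f : M → N) (ν : (x : M) → Submodule ℝ (TangentSpace 𝓘(ℝ, F) (f x))) (x : M) :
    Submodule ℝ (TangentSpace 𝓘(ℝ, F) (f x)) :=
  (ν x)ᗮ ⊓ normalSpace (E := E) f x

/-- `f : M → N` is a QR-submanifold with respect to the decomposition of the normal bundle into
`ν` and its orthogonal complement `ν^⊥`: every `J i` maps `ν` into `ν` and `ν^⊥` into `TM`. -/
structure IsQRSubmanifold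
    (J : Fin 3 → (p : N) → TangentSpace 𝓘(ℝ, F) p →L[ℝ] TangentSpace 𝓘(ℝ, F) p)
    (f : M → N) (ν : (x : M) → Submodule ℝ (TangentSpace 𝓘(ℝ, F) (f x))) : Prop where
  immersion : Manifold.IsImmersion 𝓘(ℝ, E) 𝓘(ℝ, F) ∞ f
  subbundle : IsSmoothSubbundle (E := E) f ν
  le_normal : ∀ x, ν x ≤ normalSpace (E := E) f x
  invariant : ∀ i x, ∀ w ∈ ν x, J i (f x) w ∈ ν x
  tangent : ∀ i x, ∀ w ∈ normalCompl (E := E) f ν x, J i (f x) w ∈ tangentImage (E := E) f x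

/-- A QR-submanifold of the hypersurface type: `ν^⊥` is a line bundle. -/
structure IsHypersurfaceTypeQR
    (J : Fin 3 → (p : N) → TangentSpace 𝓘(ℝ, F) p →L[ℝ] TangentSpace 𝓘(ℝ, F) p)
    (f : M → N) (ν : (x : M) → Submodule ℝ (TangentSpace 𝓘(ℝ, F) (f x))) : Prop
    extends IsQRSubmanifold (E := E) J f ν where
  rank_one : ∀ x, Module.finrank ℝ (normalCompl (E := E) f ν x) = 1

/-- The vector field `J i X` on `M`, where `X` is a vector field on `M` whose image under the
ambient `J i` is tangent to `M`. -/
def applyJ (J : Fin 3 → (p : N) → TangentSpace 𝓘(ℝ, F) p →L[ℝ] TangentSpace 𝓘(ℝ, F) p)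
    (f : M → N) (i : Fin 3) (X : (x : M) → TangentSpace 𝓘(ℝ, E) x) (x : M) :
    TangentSpace 𝓘(ℝ, E) x :=
  toTangent f x (J i (f x) (df f x (X x)))

/-- The vector field `ξ i = J i n` on `M`. -/
def xi (J : Fin 3 → (p : N) → TangentSpace 𝓘(ℝ, F) p →L[ℝ] TangentSpace 𝓘(ℝ, F) p)
    (f : M → N) (n : (x : M) → TangentSpace 𝓘(ℝ, F) (f x)) (i : Fin 3) (x : M) :
    TangentSpace 𝓘(ℝ, E) x :=
  toTangent f x (J i (f x) (n x))

/-- The covariant derivative `(∇_u J i)(X) = ∇_u (J i X) - J i (∇_u X)` with respect to the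
connection `covM` of `M`. Since `∇_u X` may have a component along `ξ i`, which `J i` maps to a
normal vector, the value is a tangent vector of the ambient manifold. -/
def covDerivJ (J : Fin 3 → (p : N) → TangentSpace 𝓘(ℝ, F) p →L[ℝ] TangentSpace 𝓘(ℝ, F) p)
    (f : M → N) (covM : CovariantDerivative 𝓘(ℝ, E) E (fun x : M ↦ TangentSpace 𝓘(ℝ, E) x))
    (i : Fin 3) (X : (x : M) → TangentSpace 𝓘(ℝ, E) x) (x : M) (u : TangentSpace 𝓘(ℝ, E) x) :
    TangentSpace 𝓘(ℝ, F) (f x) :=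
  df f x (covM (applyJ J f i X) x u) - J i (f x) (df f x (covM X x u))

end Submanifold

end QRSubmanifold

end

/-! Both formulas come from computing one ambient derivative in two ways. Since `J i` is parallel,
it commutes with the connection pulled back along `f` (`IsHyperKahler.covAlong_J`). The Gauss
formula (`covAlong_df`) splits the derivative of a tangent field into its intrinsic derivative and
the second fundamental form. For `n` this gives `∇_u ξ + b(ξ, u) = J (∇̄_u n)`. For `X` it gives
`∇_u (J X) + b(J X, u) = J (∇_u X) + J b(X, u)`.

The tangency of `J X` is linear algebra (`IsHypersurfaceTypeQR.J_mem_tangentImage`): a normal vector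
is `a + c n` with `a` in `ν`, and `J` is skew, so the pairing with `J X` only involves `J a`, which
is normal, and `J n`, which is orthogonal to `X` by assumption. Smoothness on `M` is read off from
smoothness along `f`, because `f` is an immersion (`smoothFieldOn_of_df`).

The Gauss formula is the uniqueness of the Levi-Civita connection in disguise. The difference
`gaussDefect` between the two derivatives is tensorial; absence of torsion makes it symmetric, and
metricity makes its tangential part skew. Hence that part vanishes and the difference is the second
fundamental form. -/

noncomputable section

namespace QRSubmanifold

/-! ### Calculus of the pullback connection. -/

section Along

variable {E : Type*} [NormedAddCommGroup E] [NormedSpace ℝ E] [FiniteDimensional ℝ E]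
  {M : Type*} [TopologicalSpace M] [ChartedSpace E M] [IsManifold 𝓘(ℝ, E) ∞ M]
  {F : Type*} [NormedAddCommGroup F] [NormedSpace ℝ F] [FiniteDimensional ℝ F]
  {N : Type*} [TopologicalSpace N] [ChartedSpace F N] [IsManifold 𝓘(ℝ, F) ∞ N]

/-- `V` is, as a vector field along `f`, differentiable at `x`. -/
def MDiffAlongAt (f : M → N) (V : (x : M) → TangentSpace 𝓘(ℝ, F) (f x)) (x : M) : Prop :=
  MDifferentiableAt 𝓘(ℝ, E) (𝓘(ℝ, F).prod 𝓘(ℝ, F))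
    (fun y ↦ (⟨f y, V y⟩ : TangentBundle 𝓘(ℝ, F) N)) x

/-- `Y` is a vector field which is differentiable at `p`. -/
def MDiffFieldAt (Y : (q : N) → TangentSpace 𝓘(ℝ, F) q) (p : N) : Prop :=
  MDifferentiableAt 𝓘(ℝ, F) (𝓘(ℝ, F).prod 𝓘(ℝ, F))
    (fun q ↦ (⟨q, Y q⟩ : TangentBundle 𝓘(ℝ, F) N)) p

/-- The coordinates of a tangent vector at `p` in the trivialization at `p₀`. -/
def coord (p₀ p : N) : TangentSpace 𝓘(ℝ, F) p →L[ℝ] F :=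
  (trivializationAt F (fun p : N ↦ TangentSpace 𝓘(ℝ, F) p) p₀).continuousLinearMapAt ℝ p

/-- The tangent vector at `p` with given coordinates in the trivialization at `p₀`. -/
def ofCoord (p₀ p : N) : F →L[ℝ] TangentSpace 𝓘(ℝ, F) p :=
  (trivializationAt F (fun p : N ↦ TangentSpace 𝓘(ℝ, F) p) p₀).symmL ℝ p

/-- The domain of the trivialization of the tangent bundle at `p₀`. -/
def coordDomain (F : Type*) [NormedAddCommGroup F] [NormedSpace ℝ F]
    {N : Type*} [TopologicalSpace N] [ChartedSpace F N] [IsManifold 𝓘(ℝ, F) ∞ N] (p₀ : N) : Set N :=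
  (trivializationAt F (fun p : N ↦ TangentSpace 𝓘(ℝ, F) p) p₀).baseSet

omit [FiniteDimensional ℝ F] in
theorem mem_coordDomain (p₀ : N) : p₀ ∈ coordDomain F p₀ :=
  FiberBundle.mem_baseSet_trivializationAt' p₀

omit [FiniteDimensional ℝ F] in
theorem coordDomain_mem_nhds (p₀ : N) : coordDomain F p₀ ∈ nhds p₀ :=
  (trivializationAt F (fun p : N ↦ TangentSpace 𝓘(ℝ, F) p) p₀).open_baseSet.mem_nhds
    (mem_coordDomain p₀)

omit [FiniteDimensional ℝ F] in
theorem coord_apply {p₀ p : N} (hp : p ∈ coordDomain F p₀) (v : TangentSpace 𝓘(ℝ, F) p) :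
    coord p₀ p v = (trivializationAt F (fun p : N ↦ TangentSpace 𝓘(ℝ, F) p) p₀
      (⟨p, v⟩ : TangentBundle 𝓘(ℝ, F) N)).2 :=
  Trivialization.continuousLinearMapAt_apply_of_mem (R := ℝ) _ hp v

omit [FiniteDimensional ℝ F] in
theorem ofCoord_apply {p₀ p : N} (hp : p ∈ coordDomain F p₀) (a : F) :
    ofCoord p₀ p a = (trivializationAt F (fun p : N ↦ TangentSpace 𝓘(ℝ, F) p) p₀).symm p a :=
  Trivialization.symmL_apply _ hp a

omit [FiniteDimensional ℝ F] in
theorem ofCoord_coord {p₀ p : N} (hp : p ∈ coordDomain F p₀) (v : TangentSpace 𝓘(ℝ, F) p) :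
    ofCoord p₀ p (coord p₀ p v) = v :=
  Trivialization.symmL_continuousLinearMapAt _ hp v

omit [FiniteDimensional ℝ F] in
theorem coord_ofCoord {p₀ p : N} (hp : p ∈ coordDomain F p₀) (a : F) :
    coord p₀ p (ofCoord p₀ p a) = a :=
  Trivialization.continuousLinearMapAt_symmL _ hp a

omit [FiniteDimensional ℝ F] in
theorem extend_eq_ofCoord {p₀ p : N} (hp : p ∈ coordDomain F p₀) (v : TangentSpace 𝓘(ℝ, F) p₀) :
    FiberBundle.extend F v p = ofCoord p₀ p (coord p₀ p₀ v) := by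
  rw [ofCoord_apply hp, coord_apply (mem_coordDomain p₀)]
  rfl

omit [FiniteDimensional ℝ E] [IsManifold 𝓘(ℝ, E) ∞ M] [FiniteDimensional ℝ F] in
theorem mdiffAlongAt_iff {f : M → N} {V : (x : M) → TangentSpace 𝓘(ℝ, F) (f x)} {x : M} :
    MDiffAlongAt (E := E) f V x ↔ MDifferentiableAt 𝓘(ℝ, E) 𝓘(ℝ, F) f x ∧
      MDifferentiableAt 𝓘(ℝ, E) 𝓘(ℝ, F) (fun y ↦ coord (f x) (f y) (V y)) x := by
  rw [MDiffAlongAt, mdifferentiableAt_totalSpace]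
  refine and_congr_right fun hf ↦ ?_
  apply Filter.EventuallyEq.mdifferentiableAt_iff
  filter_upwards [hf.continuousAt (coordDomain_mem_nhds (F := F) (f x))] with y hy
  exact (coord_apply hy _).symm

omit [FiniteDimensional ℝ F] in
theorem mdiffFieldAt_iff {Y : (q : N) → TangentSpace 𝓘(ℝ, F) q} {p : N} :
    MDiffFieldAt Y p ↔ MDifferentiableAt 𝓘(ℝ, F) 𝓘(ℝ, F) (fun q ↦ coord p q (Y q)) p :=
  (mdiffAlongAt_iff (E := F) (f := fun q : N ↦ q)).trans (and_iff_right mdifferentiableAt_id)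

omit [FiniteDimensional ℝ E] [IsManifold 𝓘(ℝ, E) ∞ M] [FiniteDimensional ℝ F] in
theorem covAlong_eq (cov : CovariantDerivative 𝓘(ℝ, F) F (fun p : N ↦ TangentSpace 𝓘(ℝ, F) p))
    {f : M → N} {V : (x : M) → TangentSpace 𝓘(ℝ, F) (f x)} {x : M} (hf : ContinuousAt f x)
    (u : TangentSpace 𝓘(ℝ, E) x) :
    covAlong cov f V x u =
      ofCoord (f x) (f x) (mvfderiv 𝓘(ℝ, E) (fun y ↦ coord (f x) (f y) (V y)) x u) +
        cov (FiberBundle.extend F (V x)) (f x) (df f x u) := by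
  rw [ofCoord_apply (mem_coordDomain (F := F) _)]
  have : (fun y ↦ coord (f x) (f y) (V y)) =ᶠ[nhds x] fun y ↦
      (trivializationAt F (fun p : N ↦ TangentSpace 𝓘(ℝ, F) p) (f x)
        (⟨f y, V y⟩ : TangentBundle 𝓘(ℝ, F) N)).2 := by
    filter_upwards [hf (coordDomain_mem_nhds (F := F) (f x))] with y hy
    exact coord_apply hy _
  rw [mvfderiv, this.mfderiv_eq]
  rfl

omit [FiniteDimensional ℝ E] [IsManifold 𝓘(ℝ, E) ∞ M] [FiniteDimensional ℝ F] in
theorem coord_smul_eq (p₀ p : N) (c : ℝ) (v : TangentSpace 𝓘(ℝ, F) p) :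
    coord p₀ p (c • v) = c • coord p₀ p v := map_smul _ _ _

/-- In the trivialization at `p`, a covariant derivative differs from the derivative of the
coordinates by a tensor. -/
theorem exists_christoffel
    (cov : CovariantDerivative 𝓘(ℝ, F) F (fun p : N ↦ TangentSpace 𝓘(ℝ, F) p)) (p : N)
    (w : TangentSpace 𝓘(ℝ, F) p) :
    ∃ Γ : TangentSpace 𝓘(ℝ, F) p →L[ℝ] TangentSpace 𝓘(ℝ, F) p,
      (∀ Y : (q : N) → TangentSpace 𝓘(ℝ, F) q, MDiffFieldAt Y p →
        cov Y p w = ofCoord p p (mvfderiv 𝓘(ℝ, F) (fun q ↦ coord p q (Y q)) p w) + Γ (Y p)) ∧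
      ∀ v, cov (FiberBundle.extend F v) p w = Γ v := by
  -- The covariant derivative and the derivative of coordinates obey the same Leibniz rule, so their
  -- difference `Φ` is linear over functions and depends only on the value at `p`.
  let Φ : ((q : N) → TangentSpace 𝓘(ℝ, F) q) → TangentSpace 𝓘(ℝ, F) p := fun Y ↦
    cov Y p w - ofCoord p p (mvfderiv 𝓘(ℝ, F) (fun q ↦ coord p q (Y q)) p w)
  have hdiff {Y : (q : N) → TangentSpace 𝓘(ℝ, F) q} (hY : MDiffFieldAt Y p) :
      MDifferentiableAt 𝓘(ℝ, F) 𝓘(ℝ, F) (fun q ↦ coord p q (Y q)) p :=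
    mdiffFieldAt_iff.1 hY
  have hΦ : TensorialAt 𝓘(ℝ, F) F Φ p := by
    constructor
    · intro a Y ha hY
      have h1 := cov.isCovariantDerivativeOnUniv.leibniz hY ha
      have h2 : (fun q ↦ coord p q ((a • Y) q)) = fun q ↦ a q • coord p q (Y q) := by
        funext q; exact coord_smul_eq p q _ _
      simp only [Φ, h2, mvfderiv_fun_smul ha (hdiff hY), h1]
      simp [ofCoord_coord (mem_coordDomain (F := F) p), smul_sub]
    · intro Y Y' hY hY'
      have h1 := cov.isCovariantDerivativeOnUniv.add hY hY'
      have h2 : (fun q ↦ coord p q ((Y + Y') q)) = fun q ↦ coord p q (Y q) + coord p q (Y' q) := by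
        funext q; exact map_add _ _ _
      simp only [Φ, h2, mvfderiv_fun_add (hdiff hY) (hdiff hY'), h1]
      simp only [add_apply, map_add]
      abel
  refine ⟨TensorialAt.mkHom Φ p hΦ, fun Y hY ↦ ?_, fun v ↦ ?_⟩
  · rw [TensorialAt.mkHom_apply hΦ hY]
    simp
  · rw [TensorialAt.mkHom_apply_eq_extend]
    -- `FiberBundle.extend` has constant coordinates near `p`, so only the tensor survives.
    have : (fun q ↦ coord p q (FiberBundle.extend F v q)) =ᶠ[nhds p] fun _ ↦ coord p p v := by
      filter_upwards [coordDomain_mem_nhds (F := F) p] with q hq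
      rw [extend_eq_ofCoord hq, coord_ofCoord hq]
    have h0 : mvfderiv 𝓘(ℝ, F) (fun q ↦ coord p q (FiberBundle.extend F v q)) p = 0 := by
      rw [mvfderiv, this.mfderiv_eq, mfderiv_const]
      exact ContinuousLinearMap.comp_zero _
    simp [Φ, h0]

variable (cov : CovariantDerivative 𝓘(ℝ, F) F (fun p : N ↦ TangentSpace 𝓘(ℝ, F) p))
  {f : M → N} {V W : (x : M) → TangentSpace 𝓘(ℝ, F) (f x)} {x : M}

omit [FiniteDimensional ℝ E] [IsManifold 𝓘(ℝ, E) ∞ M] [FiniteDimensional ℝ F] in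
theorem MDiffAlongAt.add (hV : MDiffAlongAt (E := E) f V x) (hW : MDiffAlongAt (E := E) f W x) :
    MDiffAlongAt (E := E) f (fun y ↦ V y + W y) x := by
  rw [mdiffAlongAt_iff] at *
  refine ⟨hV.1, ?_⟩
  simp only [map_add]
  exact hV.2.add hW.2

omit [FiniteDimensional ℝ E] [IsManifold 𝓘(ℝ, E) ∞ M] [FiniteDimensional ℝ F] in
theorem MDiffAlongAt.smul (hV : MDiffAlongAt (E := E) f V x) {a : M → ℝ}
    (ha : MDifferentiableAt 𝓘(ℝ, E) 𝓘(ℝ, ℝ) a x) :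
    MDiffAlongAt (E := E) f (fun y ↦ a y • V y) x := by
  rw [mdiffAlongAt_iff] at *
  refine ⟨hV.1, ?_⟩
  simp only [coord_smul_eq]
  exact ha.smul hV.2

omit [FiniteDimensional ℝ E] [IsManifold 𝓘(ℝ, E) ∞ M] in
theorem covAlong_add (hV : MDiffAlongAt (E := E) f V x) (hW : MDiffAlongAt (E := E) f W x)
    (u : TangentSpace 𝓘(ℝ, E) x) :
    covAlong cov f (fun y ↦ V y + W y) x u = covAlong cov f V x u + covAlong cov f W x u := by
  obtain ⟨Γ, -, hΓ⟩ := exists_christoffel cov (f x) (df f x u)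
  rw [mdiffAlongAt_iff] at hV hW
  simp only [covAlong_eq cov hV.1.continuousAt, hΓ, map_add, mvfderiv_fun_add hV.2 hW.2,
    add_apply]
  abel

omit [FiniteDimensional ℝ E] [IsManifold 𝓘(ℝ, E) ∞ M] in
theorem covAlong_smul (hV : MDiffAlongAt (E := E) f V x) {a : M → ℝ}
    (ha : MDifferentiableAt 𝓘(ℝ, E) 𝓘(ℝ, ℝ) a x) (u : TangentSpace 𝓘(ℝ, E) x) :
    covAlong cov f (fun y ↦ a y • V y) x u =
      a x • covAlong cov f V x u + mvfderiv 𝓘(ℝ, E) a x u • V x := by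
  obtain ⟨Γ, -, hΓ⟩ := exists_christoffel cov (f x) (df f x u)
  rw [mdiffAlongAt_iff] at hV
  simp only [covAlong_eq cov hV.1.continuousAt, hΓ, coord_smul_eq, mvfderiv_fun_smul ha hV.2]
  simp [ofCoord_coord (mem_coordDomain (F := F) (f x))]
  abel

omit [FiniteDimensional ℝ E] [IsManifold 𝓘(ℝ, E) ∞ M] [FiniteDimensional ℝ F] in
theorem covAlong_congr (hf : ContinuousAt f x) (h : ∀ᶠ y in nhds x, V y = W y)
    (u : TangentSpace 𝓘(ℝ, E) x) :
    covAlong cov f V x u = covAlong cov f W x u := by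
  have h' : (fun y ↦ coord (f x) (f y) (V y)) =ᶠ[nhds x] fun y ↦ coord (f x) (f y) (W y) := by
    filter_upwards [h] with y hy
    rw [hy]
  rw [covAlong_eq cov hf, covAlong_eq cov hf, mvfderiv, mvfderiv, h'.mfderiv_eq, h.self_of_nhds]

omit [FiniteDimensional ℝ E] [IsManifold 𝓘(ℝ, E) ∞ M] [FiniteDimensional ℝ F] in
theorem MDiffFieldAt.comp {Y : (q : N) → TangentSpace 𝓘(ℝ, F) q}
    (hY : MDiffFieldAt Y (f x)) (hf : MDifferentiableAt 𝓘(ℝ, E) 𝓘(ℝ, F) f x) :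
    MDiffAlongAt (E := E) f (fun y ↦ Y (f y)) x :=
  MDifferentiableAt.comp x (f := f) (g := fun q ↦ (⟨q, Y q⟩ : TangentBundle 𝓘(ℝ, F) N)) hY hf

omit [FiniteDimensional ℝ E] [IsManifold 𝓘(ℝ, E) ∞ M] [FiniteDimensional ℝ F]
  [IsManifold 𝓘(ℝ, F) ∞ N] in
theorem mvfderiv_comp_df {G : Type*} [NormedAddCommGroup G] [NormedSpace ℝ G] {g : N → G}
    (hg : MDifferentiableAt 𝓘(ℝ, F) 𝓘(ℝ, G) g (f x))
    (hf : MDifferentiableAt 𝓘(ℝ, E) 𝓘(ℝ, F) f x) (u : TangentSpace 𝓘(ℝ, E) x) :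
    mvfderiv 𝓘(ℝ, E) (fun y ↦ g (f y)) x u = mvfderiv 𝓘(ℝ, F) g (f x) (df f x u) :=
  mfderiv_comp_apply (g := g) x hg hf u

omit [FiniteDimensional ℝ E] [IsManifold 𝓘(ℝ, E) ∞ M] in
-- The chain rule in coordinates. With additivity, the Leibniz rule and locality it determines the
-- pullback connection; these are the four cases of `MDiffAlongAt.induction`.
theorem covAlong_comp {Y : (q : N) → TangentSpace 𝓘(ℝ, F) q}
    (hY : MDiffFieldAt Y (f x)) (hf : MDifferentiableAt 𝓘(ℝ, E) 𝓘(ℝ, F) f x)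
    (u : TangentSpace 𝓘(ℝ, E) x) :
    covAlong cov f (fun y ↦ Y (f y)) x u = cov Y (f x) (df f x u) := by
  obtain ⟨Γ, hΓ', hΓ⟩ := exists_christoffel cov (f x) (df f x u)
  have h := mvfderiv_comp_df (mdiffFieldAt_iff.1 hY) hf u
  rw [hΓ' Y hY, covAlong_eq cov hf.continuousAt, hΓ]
  exact congrArg (fun a ↦ ofCoord (f x) (f x) a + Γ (Y (f x))) h

omit [FiniteDimensional ℝ F] in
theorem mdiffFieldAt_extend {p : N} (v : TangentSpace 𝓘(ℝ, F) p) :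
    MDiffFieldAt (FiberBundle.extend F v) p :=
  FiberBundle.mdifferentiableAt_extend ..

omit [FiniteDimensional ℝ E] [IsManifold 𝓘(ℝ, E) ∞ M] in
/-- Induction principle for differentiable vector fields along a map: locally they are sums of
multiples of restrictions of vector fields of the target. -/
theorem MDiffAlongAt.induction {P : ((y : M) → TangentSpace 𝓘(ℝ, F) (f y)) → Prop}
    (comp : ∀ Y : (q : N) → TangentSpace 𝓘(ℝ, F) q, MDiffFieldAt Y (f x) →
      P fun y ↦ Y (f y))
    (add : ∀ V W, MDiffAlongAt (E := E) f V x → MDiffAlongAt (E := E) f W x → P V → P W →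
      P fun y ↦ V y + W y)
    (smul : ∀ (a : M → ℝ) V, MDifferentiableAt 𝓘(ℝ, E) 𝓘(ℝ, ℝ) a x →
      MDiffAlongAt (E := E) f V x → P V → P fun y ↦ a y • V y)
    (congr : ∀ V W, MDiffAlongAt (E := E) f V x → MDiffAlongAt (E := E) f W x →
      (∀ᶠ y in nhds x, V y = W y) → P V → P W)
    (hV : MDiffAlongAt (E := E) f V x) : P V := by
  classical
  have hf := (mdiffAlongAt_iff.1 hV).1
  -- Over the trivialization domain, `V` is the combination of the ambient frame fields `s i`,
  -- restricted to `f`, with coefficients `a i`. The equality holds only near `x`, whence the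
  -- `congr` case.
  let b := Module.finBasis ℝ F
  let s (i : Fin (Module.finrank ℝ F)) (q : N) : TangentSpace 𝓘(ℝ, F) q :=
    FiberBundle.extend F (ofCoord (f x) (f x) (b i)) q
  let a (i : Fin (Module.finrank ℝ F)) (y : M) : ℝ := b.coord i (coord (f x) (f y) (V y))
  have hs i : MDiffFieldAt (s i) (f x) := mdiffFieldAt_extend _
  have ha i : MDifferentiableAt 𝓘(ℝ, E) 𝓘(ℝ, ℝ) (a i) x :=
    ((b.coord i).toContinuousLinearMap.differentiableAt.comp_mdifferentiableAt
      (mdiffAlongAt_iff.1 hV).2)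
  have key (t : Finset (Fin (Module.finrank ℝ F))) :
      MDiffAlongAt (E := E) f (fun y ↦ ∑ i ∈ t, a i y • s i (f y)) x ∧
        P fun y ↦ ∑ i ∈ t, a i y • s i (f y) := by
    induction t using Finset.induction_on with
    | empty =>
      have h0 : MDiffFieldAt (fun q : N ↦ (0 : TangentSpace 𝓘(ℝ, F) q)) (f x) := by
        rw [mdiffFieldAt_iff]
        simp only [map_zero]
        exact mdifferentiableAt_const
      simp only [Finset.sum_empty]
      exact ⟨h0.comp hf, comp _ h0⟩
    | insert i t hi ih =>
      have h1 := ((hs i).comp hf).smul (ha i)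
      simp only [Finset.sum_insert hi]
      exact ⟨h1.add ih.1, add _ _ h1 ih.1 (smul _ _ (ha i) ((hs i).comp hf) (comp _ (hs i))) ih.2⟩
  refine congr _ _ (key Finset.univ).1 hV ?_ (key Finset.univ).2
  filter_upwards [hf.continuousAt (coordDomain_mem_nhds (F := F) (f x))] with y hy
  have hy' : f y ∈ coordDomain F (f x) := hy
  simp only [s, a, extend_eq_ofCoord hy', coord_ofCoord (mem_coordDomain (F := F) (f x)),
    ← map_smul, ← map_sum]
  rw [← ofCoord_coord hy' (V y)]
  congr 1
  simp [coord_ofCoord hy', b.sum_repr]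

end Along

/-! ### Parallel endomorphisms and the metric along a map. -/

section AlongRiemannian

variable {E : Type*} [NormedAddCommGroup E] [NormedSpace ℝ E]
  {M : Type*} [TopologicalSpace M] [ChartedSpace E M]
  {F : Type*} [NormedAddCommGroup F] [NormedSpace ℝ F] [FiniteDimensional ℝ F]
  {N : Type*} [TopologicalSpace N] [ChartedSpace F N] [IsManifold 𝓘(ℝ, F) ∞ N]
  [RiemannianBundle (fun p : N ↦ TangentSpace 𝓘(ℝ, F) p)]
  [IsContMDiffRiemannianBundle 𝓘(ℝ, F) ∞ F (fun p : N ↦ TangentSpace 𝓘(ℝ, F) p)]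
  {cov : CovariantDerivative 𝓘(ℝ, F) F (fun p : N ↦ TangentSpace 𝓘(ℝ, F) p)}
  {J : Fin 3 → (p : N) → TangentSpace 𝓘(ℝ, F) p →L[ℝ] TangentSpace 𝓘(ℝ, F) p}
  {f : M → N} {V W : (x : M) → TangentSpace 𝓘(ℝ, F) (f x)} {x : M}

theorem IsHyperKahler.smoothAlongOn (hJ : IsHyperKahler cov J) (i : Fin 3) {U : Set M}
    (hf : ContMDiff 𝓘(ℝ, E) 𝓘(ℝ, F) ∞ f) (hV : SmoothAlongOn (E := E) f V U) :
    SmoothAlongOn (E := E) f (fun y ↦ J i (f y) (V y)) U :=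
  ContMDiffOn.clm_bundle_apply (b := f) (ϕ := fun y ↦ J i (f y))
    ((hJ.smooth i).comp hf).contMDiffOn hV

theorem IsHyperKahler.mdiffAlongAt (hJ : IsHyperKahler cov J) (i : Fin 3)
    (hV : MDiffAlongAt (E := E) f V x) :
    MDiffAlongAt (E := E) f (fun y ↦ J i (f y) (V y)) x :=
  MDifferentiableAt.clm_bundle_apply (b := f) (ϕ := fun y ↦ J i (f y))
    (((hJ.smooth i).mdifferentiable (by simp) (f x)).comp x (mdiffAlongAt_iff.1 hV).1) hV

/-- A parallel endomorphism field commutes with the covariant derivative along a map. -/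
theorem IsHyperKahler.covAlong_J (hJ : IsHyperKahler cov J) (i : Fin 3)
    (hV : MDiffAlongAt (E := E) f V x) (u : TangentSpace 𝓘(ℝ, E) x) :
    covAlong cov f (fun y ↦ J i (f y) (V y)) x u = J i (f x) (covAlong cov f V x u) := by
  have hf := (mdiffAlongAt_iff.1 hV).1
  -- Parallelism concerns fields on `N`, and a field along `f` need not be the restriction of one;
  -- the induction bridges this gap.
  refine hV.induction (P := fun V ↦ covAlong cov f (fun y ↦ J i (f y) (V y)) x u =
    J i (f x) (covAlong cov f V x u)) ?comp ?add ?smul ?congr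
  case comp =>
    intro Y hY
    have hJY : MDiffFieldAt (fun q ↦ J i q (Y q)) (f x) :=
      hJ.mdiffAlongAt (f := fun q : N ↦ q) i hY
    rw [covAlong_comp cov hJY hf, covAlong_comp cov hY hf, hJ.parallel i Y (f x) hY]
  case add =>
    intro V W hV hW h h'
    simp only [map_add, covAlong_add cov (hJ.mdiffAlongAt i hV) (hJ.mdiffAlongAt i hW),
      covAlong_add cov hV hW, h, h']
  case smul =>
    intro a V ha hV h
    simp only [map_smul, map_add, covAlong_smul cov (hJ.mdiffAlongAt i hV) ha,
      covAlong_smul cov hV ha, h]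
  case congr =>
    intro V W hV hW hVW h
    rw [← covAlong_congr cov hf.continuousAt hVW, ← h]
    exact covAlong_congr cov hf.continuousAt (hVW.mono fun y hy ↦ by rw [hy]) u

omit [FiniteDimensional ℝ F] in
theorem mdifferentiableAt_inner (hV : MDiffAlongAt (E := E) f V x)
    (hW : MDiffAlongAt (E := E) f W x) :
    MDifferentiableAt 𝓘(ℝ, E) 𝓘(ℝ, ℝ) (fun y ↦ inner ℝ (V y) (W y)) x :=
  MDifferentiableAt.inner_bundle hV hW

/-- A metric connection induces metric covariant derivatives along maps. -/
theorem IsLeviCivita.mvfderiv_inner (hcov : IsLeviCivita cov) (hV : MDiffAlongAt (E := E) f V x)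
    (hW : MDiffAlongAt (E := E) f W x) (u : TangentSpace 𝓘(ℝ, E) x) :
    mvfderiv 𝓘(ℝ, E) (fun y ↦ inner ℝ (V y) (W y)) x u =
      inner ℝ (covAlong cov f V x u) (W x) + inner ℝ (V x) (covAlong cov f W x u) := by
  have hf := (mdiffAlongAt_iff.1 hV).1
  -- Both sides are additive and obey the Leibniz rule in each argument, so an induction in `V`, and
  -- inside it one in `W`, reduces to two ambient fields.
  refine hV.induction (P := fun V ↦ mvfderiv 𝓘(ℝ, E) (fun y ↦ inner ℝ (V y) (W y)) x u =
    inner ℝ (covAlong cov f V x u) (W x) + inner ℝ (V x) (covAlong cov f W x u))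
    ?comp ?add ?smul ?congr
  case comp =>
    intro Y hY
    refine hW.induction (P := fun W ↦
      mvfderiv 𝓘(ℝ, E) (fun y ↦ inner ℝ (Y (f y)) (W y)) x u =
        inner ℝ (covAlong cov f (fun y ↦ Y (f y)) x u) (W x) +
          inner ℝ (Y (f x)) (covAlong cov f W x u)) ?_ ?_ ?_ ?_
    · intro Z hZ
      have h := hcov.metric.mvfderiv_inner_eq (FiberBundle.extend F (df f x u)) hY hZ
      simp only [FiberBundle.extend_apply_self] at h
      rw [covAlong_comp cov hY hf, covAlong_comp cov hZ hf, ← h]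
      exact mvfderiv_comp_df (g := fun q ↦ inner ℝ (Y q) (Z q))
        (mdifferentiableAt_inner (f := fun q : N ↦ q) hY hZ) hf u
    · intro V W hV hW h h'
      simp only [inner_add_right, covAlong_add cov hV hW,
        mvfderiv_fun_add (mdifferentiableAt_inner (hY.comp hf) hV)
          (mdifferentiableAt_inner (hY.comp hf) hW), add_apply, h, h']
      abel
    · intro a V ha hV h
      simp only [inner_add_right, inner_smul_right, covAlong_smul cov hV ha,
        mvfderiv_fun_mul ha (mdifferentiableAt_inner (hY.comp hf) hV), add_apply, smul_apply,
        smul_eq_mul, h]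
      ring
    · intro V W hV hW hVW h
      rw [← covAlong_congr cov hf.continuousAt hVW, ← hVW.self_of_nhds, ← h]
      have : (fun y ↦ inner ℝ (Y (f y)) (W y)) =ᶠ[nhds x] fun y ↦ inner ℝ (Y (f y)) (V y) :=
        hVW.mono fun y hy ↦ by simp only [hy]
      rw [mvfderiv, mvfderiv, this.mfderiv_eq]
      rfl
  case add =>
    intro V V' hV hV' h h'
    simp only [inner_add_left, covAlong_add cov hV hV',
      mvfderiv_fun_add (mdifferentiableAt_inner hV hW) (mdifferentiableAt_inner hV' hW),
      add_apply, h, h']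
    abel
  case smul =>
    intro a V ha hV h
    simp only [inner_add_left, real_inner_smul_left, covAlong_smul cov hV ha,
      mvfderiv_fun_mul ha (mdifferentiableAt_inner hV hW), add_apply, smul_apply,
      smul_eq_mul, h]
    ring
  case congr =>
    intro V V' hV hV' hVV' h
    rw [← covAlong_congr cov hf.continuousAt hVV', ← hVV'.self_of_nhds, ← h]
    have : (fun y ↦ inner ℝ (V' y) (W y)) =ᶠ[nhds x] fun y ↦ inner ℝ (V y) (W y) :=
      hVV'.mono fun y hy ↦ by simp only [hy]
    rw [mvfderiv, mvfderiv, this.mfderiv_eq]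
    rfl

end AlongRiemannian

/-! ### Symmetry of Christoffel symbols and of second derivatives. -/

section Symmetry

variable {E : Type*} [NormedAddCommGroup E] [NormedSpace ℝ E]
  {M : Type*} [TopologicalSpace M] [ChartedSpace E M] [IsManifold 𝓘(ℝ, E) ∞ M]
  {F : Type*} [NormedAddCommGroup F] [NormedSpace ℝ F]
  {N : Type*} [TopologicalSpace N] [ChartedSpace F N] [IsManifold 𝓘(ℝ, F) ∞ N]

/-- The link between bundle coordinates and chart calculus: the trivialization of the tangent bundle
is the differential of the chart. -/
theorem ofCoord_eq_mfderivWithin {p₀ p : N} (hp : p ∈ coordDomain F p₀) {z : F}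
    (hz : z = extChartAt 𝓘(ℝ, F) p₀ p) :
    (ofCoord (F := F) p₀ p : F →L[ℝ] F) =
      (mfderivWithin 𝓘(ℝ, F) 𝓘(ℝ, F) (extChartAt 𝓘(ℝ, F) p₀).symm
        (Set.range 𝓘(ℝ, F)) z : F →L[ℝ] F) := by
  subst hz
  exact TangentBundle.symmL_trivializationAt hp

theorem coord_eq_mfderiv {p₀ p : N} (hp : p ∈ coordDomain F p₀) :
    coord (F := F) p₀ p = mfderiv 𝓘(ℝ, F) 𝓘(ℝ, F) (extChartAt 𝓘(ℝ, F) p₀) p :=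
  TangentBundle.continuousLinearMapAt_trivializationAt hp

theorem extChartAt_symm_mem_coordDomain {p : N} {z : F}
    (hz : z ∈ (extChartAt 𝓘(ℝ, F) p).target) :
    (extChartAt 𝓘(ℝ, F) p).symm z ∈ coordDomain F p := by
  have := (extChartAt 𝓘(ℝ, F) p).map_target hz
  rwa [extChartAt_source] at this

/-- Read in the chart, the extended field is constant; this is why brackets of such fields vanish.
-/
theorem mpullbackWithin_extend {p : N} (v : TangentSpace 𝓘(ℝ, F) p) :
    VectorField.mpullbackWithin 𝓘(ℝ, F) 𝓘(ℝ, F) (extChartAt 𝓘(ℝ, F) p).symm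
      (FiberBundle.extend F v) (Set.range 𝓘(ℝ, F)) =ᶠ[nhds (extChartAt 𝓘(ℝ, F) p p)]
    fun _ ↦ coord p p v := by
  filter_upwards [extChartAt_target_mem_nhds (I := 𝓘(ℝ, F)) p] with z hz
  have hz' := extChartAt_symm_mem_coordDomain hz
  rw [VectorField.mpullbackWithin_apply, extend_eq_ofCoord hz']
  refine (isInvertible_mfderivWithin_extChartAt_symm hz).inverse_apply_eq.2 ?_
  exact DFunLike.congr_fun
    (ofCoord_eq_mfderivWithin hz' ((extChartAt 𝓘(ℝ, F) p).right_inv hz).symm) (coord p p v)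

/-- Coordinate vector fields commute. -/
theorem mlieBracket_extend {p : N} (v w : TangentSpace 𝓘(ℝ, F) p) :
    VectorField.mlieBracket 𝓘(ℝ, F) (FiberBundle.extend F v) (FiberBundle.extend F w) p = 0 := by
  have h (A B : F → F) (a b z : F) (hA : A =ᶠ[nhds z] fun _ ↦ a) (hB : B =ᶠ[nhds z] fun _ ↦ b) :
      VectorField.lieBracketWithin ℝ A B
        ((extChartAt 𝓘(ℝ, F) p).symm ⁻¹' Set.univ ∩ Set.range 𝓘(ℝ, F)) z = 0 := by
    simp only [Set.preimage_univ, modelWithCornersSelf_coe, Set.range_id, Set.univ_inter,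
      VectorField.lieBracketWithin_univ]
    rw [hA.lieBracket_vectorField_eq hB]
    simp [VectorField.lieBracket]
  rw [← VectorField.mlieBracketWithin_univ, VectorField.mlieBracketWithin_apply]
  exact (congrArg _ (h _ _ _ _ _ (mpullbackWithin_extend v) (mpullbackWithin_extend w))).trans
    (ContinuousLinearMap.map_zero _)

/-- A torsion-free connection has symmetric Christoffel symbols. -/
theorem cov_extend_symm [FiniteDimensional ℝ F]
    {cov : CovariantDerivative 𝓘(ℝ, F) F (fun p : N ↦ TangentSpace 𝓘(ℝ, F) p)}
    (hcov : cov.torsion = 0) (p : N) (v w : TangentSpace 𝓘(ℝ, F) p) :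
    cov (FiberBundle.extend F v) p w = cov (FiberBundle.extend F w) p v := by
  have h := cov.torsion_apply_eq_extend v w
  rw [hcov, mlieBracket_extend, FiberBundle.extend_apply_self,
    FiberBundle.extend_apply_self] at h
  simp only [sub_zero] at h
  exact (sub_eq_zero.1 h.symm).symm

/-- The differential of `f` at `y` in the trivializations at `x` and `f x`. -/
def dfCoord (f : M → N) (x y : M) : E →L[ℝ] F :=
  (coord (f x) (f y)).comp ((df f y).comp (ofCoord x y))

variable {f : M → N}

theorem contMDiffAt_dfCoord (hf : ContMDiff 𝓘(ℝ, E) 𝓘(ℝ, F) ∞ f) (x : M) :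
    ContMDiffAt 𝓘(ℝ, E) 𝓘(ℝ, E →L[ℝ] F) ∞ (dfCoord (E := E) (F := F) f x) x :=
  (hf x).mfderiv_const (m := ∞) le_rfl

theorem dfCoord_apply (f : M → N) {x y : M} (hy : y ∈ coordDomain E x)
    (v : TangentSpace 𝓘(ℝ, E) y) :
    dfCoord (F := F) f x y (coord (F := E) x y v) = coord (F := F) (f x) (f y) (df f y v) := by
  simp [dfCoord, ofCoord_coord (F := E) hy]

/-- The identity is needed on a neighbourhood and not just at `x`, because it is differentiated once
more in `mvfderiv_df_extend_symm`. -/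
theorem dfCoord_eventuallyEq (hf : ContMDiff 𝓘(ℝ, E) 𝓘(ℝ, F) ∞ f) (x : M) :
    ∀ᶠ y in nhds x, dfCoord (F := F) f x y =
      fderiv ℝ (extChartAt 𝓘(ℝ, F) (f x) ∘ f ∘ (extChartAt 𝓘(ℝ, E) x).symm)
        (extChartAt 𝓘(ℝ, E) x y) := by
  filter_upwards [coordDomain_mem_nhds (F := E) x,
    (hf x).continuousAt (coordDomain_mem_nhds (F := F) (f x))] with y hy hfy
  have hfy' : f y ∈ coordDomain F (f x) := hfy
  have hy' : y ∈ (extChartAt 𝓘(ℝ, E) x).source := by rwa [extChartAt_source]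
  have h1 := mdifferentiableWithinAt_extChartAt_symm ((extChartAt 𝓘(ℝ, E) x).map_source hy')
  have h2 : MDifferentiableAt 𝓘(ℝ, E) 𝓘(ℝ, F) f y := (hf y).mdifferentiableAt (by simp)
  have h3 : MDifferentiableAt 𝓘(ℝ, F) 𝓘(ℝ, F) (extChartAt 𝓘(ℝ, F) (f x)) (f y) :=
    mdifferentiableAt_extChartAt hfy'
  have h4 : (extChartAt 𝓘(ℝ, E) x).symm (extChartAt 𝓘(ℝ, E) x y) = y :=
    (extChartAt 𝓘(ℝ, E) x).left_inv hy'
  have hu : UniqueMDiffWithinAt 𝓘(ℝ, E) (Set.range 𝓘(ℝ, E)) (extChartAt 𝓘(ℝ, E) x y) := by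
    simpa using uniqueMDiffWithinAt_univ 𝓘(ℝ, E)
  have h5 : dfCoord (F := F) f x y =
      inTangentCoordinates 𝓘(ℝ, E) 𝓘(ℝ, F) id f (mfderiv 𝓘(ℝ, E) 𝓘(ℝ, F) f) x y := rfl
  rw [h5, inTangentCoordinates_eq_mfderiv_comp hy hfy', ← fderivWithin_univ,
    ← mfderivWithin_eq_fderivWithin]
  have h6 : Set.range 𝓘(ℝ, E) = Set.univ := by simp
  rw [← h6]
  refine Eq.trans ?_ (mfderiv_comp_mfderivWithin_of_eq h3
    (h2.comp_mdifferentiableWithinAt_of_eq _ h1 h4) hu (congrArg f h4)).symm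
  exact congrArg (ContinuousLinearMap.comp _) (mfderiv_comp_mfderivWithin_of_eq h2 h1 hu h4).symm

/-- The second derivative of `f` in coordinates is symmetric. -/
theorem mvfderiv_df_extend_symm (hf : ContMDiff 𝓘(ℝ, E) 𝓘(ℝ, F) ∞ f) (x : M)
    (u v : TangentSpace 𝓘(ℝ, E) x) :
    mvfderiv 𝓘(ℝ, E) (fun y ↦ coord (F := F) (f x) (f y) (df f y (FiberBundle.extend E v y))) x u =
      mvfderiv 𝓘(ℝ, E)
        (fun y ↦ coord (F := F) (f x) (f y) (df f y (FiberBundle.extend E u y))) x v := by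
  set g := extChartAt 𝓘(ℝ, F) (f x) ∘ f ∘ (extChartAt 𝓘(ℝ, E) x).symm with hg
  have hgs : ContDiffAt ℝ ∞ g (extChartAt 𝓘(ℝ, E) x x) := by
    have := (contMDiffAt_iff.1 (hf x)).2
    rwa [modelWithCornersSelf_coe, Set.range_id, contDiffWithinAt_univ] at this
  have hdg : DifferentiableAt ℝ (fderiv ℝ g) (extChartAt 𝓘(ℝ, E) x x) :=
    (hgs.fderiv_right (m := 1) (by norm_cast)).differentiableAt (by simp)
  -- The extended field has constant coordinates, so no derivative falls on it and only the Hessian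
  -- of `g`, the map `f` in charts, remains. Its symmetry is Schwarz's theorem.
  have key (u v : TangentSpace 𝓘(ℝ, E) x) : mvfderiv 𝓘(ℝ, E)
      (fun y ↦ coord (F := F) (f x) (f y) (df f y (FiberBundle.extend E v y))) x u =
        fderiv ℝ (fderiv ℝ g) (extChartAt 𝓘(ℝ, E) x x) (coord x x u) (coord x x v) := by
    have h1 : (fun y ↦ coord (F := F) (f x) (f y) (df f y (FiberBundle.extend E v y)))
        =ᶠ[nhds x] fun y ↦ fderiv ℝ g (extChartAt 𝓘(ℝ, E) x y) (coord x x v) := by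
      filter_upwards [coordDomain_mem_nhds (F := E) x, dfCoord_eventuallyEq hf x] with y hy hy'
      rw [← hy', ← dfCoord_apply f hy, extend_eq_ofCoord hy, coord_ofCoord hy]
    have h2 : MDifferentiableAt 𝓘(ℝ, E) 𝓘(ℝ, F) (fun z ↦ fderiv ℝ g z (coord x x v))
        (extChartAt 𝓘(ℝ, E) x x) :=
      (hdg.clm_apply (differentiableAt_const _)).mdifferentiableAt
    have h3 := mvfderiv_comp_df h2 (mdifferentiableAt_extChartAt (mem_chart_source E x)) u
    rw [mvfderiv, h1.mfderiv_eq]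
    refine h3.trans ?_
    rw [coord_eq_mfderiv (mem_coordDomain (F := E) x)]
    rw [mvfderiv, mfderiv_eq_fderiv, fderiv_clm_apply hdg (differentiableAt_const _)]
    simp
    rfl
  rw [key, key]
  exact hgs.isSymmSndFDerivAt (by simp; norm_cast) _ _

end Symmetry

/-! ### Smoothness of fields read through an immersion. -/

section Lift

variable {E : Type*} [NormedAddCommGroup E] [NormedSpace ℝ E] [FiniteDimensional ℝ E]
  {M : Type*} [TopologicalSpace M] [ChartedSpace E M] [IsManifold 𝓘(ℝ, E) ∞ M]
  {F : Type*} [NormedAddCommGroup F] [NormedSpace ℝ F] [FiniteDimensional ℝ F]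
  {N : Type*} [TopologicalSpace N] [ChartedSpace F N] [IsManifold 𝓘(ℝ, F) ∞ N]
  {f : M → N} {X : (x : M) → TangentSpace 𝓘(ℝ, E) x} {x : M} {U : Set M}

omit [FiniteDimensional ℝ E] [FiniteDimensional ℝ F] in
theorem SmoothFieldOn.smoothAlongOn_df (hf : ContMDiff 𝓘(ℝ, E) 𝓘(ℝ, F) ∞ f)
    (hX : SmoothFieldOn X U) : SmoothAlongOn (E := E) (F := F) f (fun y ↦ df f y (X y)) U :=
  (hf.contMDiff_tangentMap (m := ∞) le_rfl).comp_contMDiffOn hX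

omit [FiniteDimensional ℝ E] [FiniteDimensional ℝ F] in
theorem MDiffFieldAt.mdiffAlongAt_df (hf : ContMDiff 𝓘(ℝ, E) 𝓘(ℝ, F) ∞ f)
    (hX : MDiffFieldAt X x) : MDiffAlongAt (E := E) (F := F) f (fun y ↦ df f y (X y)) x :=
  ((hf.contMDiff_tangentMap (m := ∞) le_rfl).mdifferentiable (by simp) _).comp x hX

omit [FiniteDimensional ℝ E] [FiniteDimensional ℝ F] [IsManifold 𝓘(ℝ, E) ∞ M] in
theorem SmoothAlongOn.mdiffAlongAt (hU : IsOpen U) {V : (x : M) → TangentSpace 𝓘(ℝ, F) (f x)}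
    (hV : SmoothAlongOn (E := E) f V U) (hx : x ∈ U) : MDiffAlongAt (E := E) f V x :=
  (hV.contMDiffAt (hU.mem_nhds hx)).mdifferentiableAt (by simp)

omit [FiniteDimensional ℝ E] in
theorem SmoothFieldOn.mdiffFieldAt (hU : IsOpen U) (hX : SmoothFieldOn X U) (hx : x ∈ U) :
    MDiffFieldAt X x :=
  (hX.contMDiffAt (hU.mem_nhds hx)).mdifferentiableAt (by simp)

/-- A vector field on the source of an immersion is smooth if its image is a smooth vector field
along the immersion. -/
theorem smoothFieldOn_of_df (hf : ContMDiff 𝓘(ℝ, E) 𝓘(ℝ, F) ∞ f)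
    (hinj : ∀ x, Function.Injective (df (E := E) (F := F) f x)) (hU : IsOpen U)
    (hV : SmoothAlongOn (E := E) (F := F) f (fun y ↦ df f y (X y)) U) : SmoothFieldOn X U := by
  intro x hx
  refine ContMDiffAt.contMDiffWithinAt ?_
  have hc := (contMDiffAt_totalSpace.1 (hV.contMDiffAt (hU.mem_nhds hx))).2
  rw [contMDiffAt_section]
  have hA0 : Function.Injective (dfCoord (E := E) (F := F) f x x) := by
    intro a b hab
    simp only [dfCoord, ContinuousLinearMap.comp_apply] at hab
    have h1 := congrArg (ofCoord (f x) (f x)) hab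
    rw [ofCoord_coord (mem_coordDomain (F := F) (f x)),
      ofCoord_coord (mem_coordDomain (F := F) (f x))] at h1
    have h2 := congrArg (coord x x) (hinj x h1)
    rwa [coord_ofCoord (mem_coordDomain (F := E) x), coord_ofCoord (mem_coordDomain (F := E) x)]
      at h2
  -- A left inverse `L` of the differential at the single point `x` suffices: `A y` is the identity
  -- at `x`, hence invertible nearby, and inversion is smooth. The coordinates of `X` are then the
  -- inverse of `A y` applied to `L` of the coordinates of `df X`.
  obtain ⟨L, hL⟩ := LinearMap.exists_leftInverse_of_injective
    (dfCoord (E := E) (F := F) f x x).toLinearMap (LinearMap.ker_eq_bot.2 hA0)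
  let A : M → E →L[ℝ] E := fun y ↦ L.toContinuousLinearMap.comp (dfCoord (F := F) f x y)
  have hA : ContMDiffAt 𝓘(ℝ, E) 𝓘(ℝ, E →L[ℝ] E) ∞ A x :=
    contMDiffAt_const.clm_comp (contMDiffAt_dfCoord hf x)
  have hAx : A x = (ContinuousLinearEquiv.refl ℝ E : E →L[ℝ] E) := by
    ext a
    exact LinearMap.congr_fun hL a
  have hinv : ContMDiffAt 𝓘(ℝ, E) 𝓘(ℝ, E →L[ℝ] E) ∞ (fun y ↦ (A y).inverse) x := by
    have : ContDiffAt ℝ ∞ ContinuousLinearMap.inverse (A x) := by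
      rw [hAx]
      exact contDiffAt_map_inverse _
    exact this.contMDiffAt.comp x hA
  have hLc := hinv.clm_apply
    ((contMDiffAt_const (c := L.toContinuousLinearMap)).clm_apply hc)
  refine hLc.congr_of_eventuallyEq ?_
  have hunit : ∀ᶠ y in nhds x, (A y).IsInvertible := by
    have h := ContinuousLinearEquiv.nhds (ContinuousLinearEquiv.refl ℝ E)
    rw [← hAx] at h
    exact hA.continuousAt h
  filter_upwards [hunit, coordDomain_mem_nhds (F := E) x,
    hf.continuous.continuousAt (coordDomain_mem_nhds (F := F) (f x))] with y hy hyx hyf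
  have hyf' : f y ∈ coordDomain F (f x) := hyf
  have h1 := dfCoord_apply (F := F) f hyx (X y)
  rw [coord_apply hyf', coord_apply hyx] at h1
  symm
  rw [hy.inverse_apply_eq]
  exact congrArg L h1.symm

end Lift

/-! ### Tensoriality and symmetry of the Gauss defect. -/

section GaussDefect

variable {E : Type*} [NormedAddCommGroup E] [NormedSpace ℝ E] [FiniteDimensional ℝ E]
  {M : Type*} [TopologicalSpace M] [ChartedSpace E M] [IsManifold 𝓘(ℝ, E) ∞ M]
  {F : Type*} [NormedAddCommGroup F] [NormedSpace ℝ F] [FiniteDimensional ℝ F]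
  {N : Type*} [TopologicalSpace N] [ChartedSpace F N] [IsManifold 𝓘(ℝ, F) ∞ N]
  {covN : CovariantDerivative 𝓘(ℝ, F) F (fun p : N ↦ TangentSpace 𝓘(ℝ, F) p)}
  {covM : CovariantDerivative 𝓘(ℝ, E) E (fun x : M ↦ TangentSpace 𝓘(ℝ, E) x)}
  {f : M → N} {x : M}

/-- The covariant derivative along `f` of the image of a vector field `X` on `M`, minus the image
of the covariant derivative of `X` on `M`. -/
def gaussDefect (covN : CovariantDerivative 𝓘(ℝ, F) F (fun p : N ↦ TangentSpace 𝓘(ℝ, F) p))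
    (covM : CovariantDerivative 𝓘(ℝ, E) E (fun x : M ↦ TangentSpace 𝓘(ℝ, E) x)) (f : M → N)
    (X : (x : M) → TangentSpace 𝓘(ℝ, E) x) (x : M) (u : TangentSpace 𝓘(ℝ, E) x) :
    TangentSpace 𝓘(ℝ, F) (f x) :=
  covAlong covN f (fun y ↦ df f y (X y)) x u - df f x (covM X x u)

omit [FiniteDimensional ℝ E] in
-- Both terms produce the same derivative-of-`a` contribution in the Leibniz rule, and these cancel.
theorem gaussDefect_tensorial (hf : ContMDiff 𝓘(ℝ, E) 𝓘(ℝ, F) ∞ f)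
    (u : TangentSpace 𝓘(ℝ, E) x) :
    TensorialAt 𝓘(ℝ, E) E (fun X ↦ gaussDefect covN covM f X x u) x where
  smul {a X} ha hX := by
    have hX' : MDiffFieldAt X x := hX
    have h1 : (fun y ↦ df (F := F) f y ((a • X) y)) = fun y ↦ a y • df f y (X y) := by
      funext y
      exact map_smul _ _ _
    have h2 := covM.isCovariantDerivativeOnUniv.leibniz hX ha
    simp only [gaussDefect, h1, covAlong_smul covN (hX'.mdiffAlongAt_df hf) ha, h2]
    simp [smul_sub]
  add {X Y} hX hY := by
    have hX' : MDiffFieldAt X x := hX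
    have hY' : MDiffFieldAt Y x := hY
    have h1 : (fun y ↦ df (F := F) f y ((X + Y) y)) = fun y ↦ df f y (X y) + df f y (Y y) := by
      funext y
      exact map_add _ _ _
    have h2 := covM.isCovariantDerivativeOnUniv.add hX hY
    simp only [gaussDefect, h1,
      covAlong_add covN (hX'.mdiffAlongAt_df hf) (hY'.mdiffAlongAt_df hf), h2, add_apply, map_add]
    abel

theorem gaussDefect_eq_extend (hf : ContMDiff 𝓘(ℝ, E) 𝓘(ℝ, F) ∞ f)
    {X : (x : M) → TangentSpace 𝓘(ℝ, E) x} (hX : MDiffFieldAt X x)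
    (u : TangentSpace 𝓘(ℝ, E) x) :
    gaussDefect covN covM f X x u = gaussDefect covN covM f (FiberBundle.extend E (X x)) x u :=
  (gaussDefect_tensorial hf u).pointwise hX (mdiffFieldAt_extend _) (by simp)

/-- On extended fields the defect consists of the Hessian of `f` and the Christoffel terms of `N`
and `M`, each of them symmetric. -/
theorem gaussDefect_symm (hN : covN.torsion = 0) (hM : covM.torsion = 0)
    (hf : ContMDiff 𝓘(ℝ, E) 𝓘(ℝ, F) ∞ f) (u v : TangentSpace 𝓘(ℝ, E) x) :
    gaussDefect covN covM f (FiberBundle.extend E v) x u =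
      gaussDefect covN covM f (FiberBundle.extend E u) x v := by
  simp only [gaussDefect, covAlong_eq covN hf.continuous.continuousAt,
    FiberBundle.extend_apply_self]
  rw [mvfderiv_df_extend_symm hf, cov_extend_symm hN, cov_extend_symm hM]

end GaussDefect

/-! ### Normality of the Gauss defect. -/

section Gauss

variable {E : Type*} [NormedAddCommGroup E] [NormedSpace ℝ E] [FiniteDimensional ℝ E]
  {M : Type*} [TopologicalSpace M] [ChartedSpace E M] [IsManifold 𝓘(ℝ, E) ∞ M]
  [RiemannianBundle (fun x : M ↦ TangentSpace 𝓘(ℝ, E) x)]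
  [IsContMDiffRiemannianBundle 𝓘(ℝ, E) ∞ E (fun x : M ↦ TangentSpace 𝓘(ℝ, E) x)]
  {F : Type*} [NormedAddCommGroup F] [NormedSpace ℝ F] [FiniteDimensional ℝ F]
  {N : Type*} [TopologicalSpace N] [ChartedSpace F N] [IsManifold 𝓘(ℝ, F) ∞ N]
  [RiemannianBundle (fun p : N ↦ TangentSpace 𝓘(ℝ, F) p)]
  [IsContMDiffRiemannianBundle 𝓘(ℝ, F) ∞ F (fun p : N ↦ TangentSpace 𝓘(ℝ, F) p)]
  {covN : CovariantDerivative 𝓘(ℝ, F) F (fun p : N ↦ TangentSpace 𝓘(ℝ, F) p)}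
  {covM : CovariantDerivative 𝓘(ℝ, E) E (fun x : M ↦ TangentSpace 𝓘(ℝ, E) x)}
  {f : M → N} {x : M}

omit [FiniteDimensional ℝ E] [IsManifold 𝓘(ℝ, E) ∞ M]
  [IsContMDiffRiemannianBundle 𝓘(ℝ, E) ∞ E (fun x : M ↦ TangentSpace 𝓘(ℝ, E) x)]
  [FiniteDimensional ℝ F] [IsManifold 𝓘(ℝ, F) ∞ N]
  [IsContMDiffRiemannianBundle 𝓘(ℝ, F) ∞ F (fun p : N ↦ TangentSpace 𝓘(ℝ, F) p)] in
theorem IsInducedMetric.df_injective (hg : IsInducedMetric (E := E) (F := F) f) (x : M) :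
    Function.Injective (df (E := E) (F := F) f x) := by
  refine (injective_iff_map_eq_zero _).2 fun u hu ↦ ?_
  have h := hg x u u
  rw [hu, inner_zero_left] at h
  exact inner_self_eq_zero.1 h

/-- The function `⟨v, w⟩ = ⟨df v, df w⟩` is differentiated with both metric connections, and the
results are subtracted. -/
theorem gaussDefect_skew (hN : IsLeviCivita covN) (hM : IsLeviCivita covM)
    (hf : ContMDiff 𝓘(ℝ, E) 𝓘(ℝ, F) ∞ f) (hg : IsInducedMetric (E := E) (F := F) f)
    (u v w : TangentSpace 𝓘(ℝ, E) x) :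
    inner ℝ (gaussDefect covN covM f (FiberBundle.extend E v) x u) (df f x w) =
      -inner ℝ (gaussDefect covN covM f (FiberBundle.extend E w) x u) (df f x v) := by
  have hv : MDiffFieldAt (FiberBundle.extend E v) x := mdiffFieldAt_extend v
  have hw : MDiffFieldAt (FiberBundle.extend E w) x := mdiffFieldAt_extend w
  have h1 := hN.mvfderiv_inner (hv.mdiffAlongAt_df hf) (hw.mdiffAlongAt_df hf) u
  have h2 := hM.metric.mvfderiv_inner_eq (FiberBundle.extend E u) hv hw
  have h3 : (fun y ↦ inner ℝ (df (F := F) f y (FiberBundle.extend E v y))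
      (df f y (FiberBundle.extend E w y))) =
      fun y ↦ inner ℝ (FiberBundle.extend E v y) (FiberBundle.extend E w y) :=
    funext fun y ↦ (hg y _ _).symm
  rw [h3] at h1
  simp only [FiberBundle.extend_apply_self] at h1 h2
  rw [h2, hg, hg] at h1
  simp only [gaussDefect, inner_sub_left]
  rw [real_inner_comm _ (df f x v), real_inner_comm _ (df f x v)] at h1
  linarith

/-- A trilinear form symmetric in its first two arguments and skew in its last two is zero:
alternating the two swaps returns to the start after three sign changes. -/
theorem gaussDefect_mem_normalSpace (hN : IsLeviCivita covN) (hM : IsLeviCivita covM)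
    (hf : ContMDiff 𝓘(ℝ, E) 𝓘(ℝ, F) ∞ f) (hg : IsInducedMetric (E := E) (F := F) f)
    (u v : TangentSpace 𝓘(ℝ, E) x) :
    gaussDefect covN covM f (FiberBundle.extend E v) x u ∈ normalSpace (E := E) f x := by
  rw [normalSpace, Submodule.mem_orthogonal']
  rintro _ ⟨w, rfl⟩
  have s (u v : TangentSpace 𝓘(ℝ, E) x) :=
    gaussDefect_symm hN.torsion_free hM.torsion_free hf u v
  have k (u v w : TangentSpace 𝓘(ℝ, E) x) := gaussDefect_skew hN hM hf hg u v w
  have h1 := k u v w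
  have h2 := k w u v
  have h3 := k v w u
  rw [s u w] at h1
  rw [s w v] at h2
  rw [s v u] at h3
  change inner ℝ _ (df f x w) = 0
  linarith

end Gauss

/-! ### Normal projection. -/

section NormalPart

variable {E : Type*} [NormedAddCommGroup E] [NormedSpace ℝ E]
  {M : Type*} [TopologicalSpace M] [ChartedSpace E M]
  {F : Type*} [NormedAddCommGroup F] [NormedSpace ℝ F] [FiniteDimensional ℝ F]
  {N : Type*} [TopologicalSpace N] [ChartedSpace F N]
  [RiemannianBundle (fun p : N ↦ TangentSpace 𝓘(ℝ, F) p)]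
  {f : M → N} {x : M}

omit [FiniteDimensional ℝ F] in
theorem df_mem_orthogonal_normalSpace (u : TangentSpace 𝓘(ℝ, E) x) :
    df (F := F) f x u ∈ (normalSpace (E := E) f x)ᗮ :=
  Submodule.le_orthogonal_orthogonal _ (LinearMap.mem_range_self _ u)

theorem normalPart_add (v w : TangentSpace 𝓘(ℝ, F) (f x)) :
    normalPart (E := E) f x (v + w) = normalPart (E := E) f x v + normalPart (E := E) f x w :=
  map_add _ _ _

theorem normalPart_of_mem_orthogonal {w : TangentSpace 𝓘(ℝ, F) (f x)}
    (hw : w ∈ (normalSpace (E := E) f x)ᗮ) : normalPart (E := E) f x w = 0 := by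
  have : FiniteDimensional ℝ (TangentSpace 𝓘(ℝ, F) (f x)) :=
    inferInstanceAs (FiniteDimensional ℝ F)
  exact (Submodule.starProjection_apply_eq_zero_iff _).2 hw

theorem normalPart_of_mem {w : TangentSpace 𝓘(ℝ, F) (f x)}
    (hw : w ∈ normalSpace (E := E) f x) : normalPart (E := E) f x w = w := by
  have : FiniteDimensional ℝ (TangentSpace 𝓘(ℝ, F) (f x)) :=
    inferInstanceAs (FiniteDimensional ℝ F)
  exact Submodule.starProjection_eq_self_iff.2 hw

theorem normalPart_df_add (u : TangentSpace 𝓘(ℝ, E) x) {z : TangentSpace 𝓘(ℝ, F) (f x)}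
    (hz : z ∈ normalSpace (E := E) f x) : normalPart (E := E) f x (df f x u + z) = z := by
  rw [normalPart_add, normalPart_of_mem_orthogonal (df_mem_orthogonal_normalSpace u),
    normalPart_of_mem hz, zero_add]

end NormalPart

/-! ### The Gauss formula. -/

section GaussFormula

variable {E : Type*} [NormedAddCommGroup E] [NormedSpace ℝ E] [FiniteDimensional ℝ E]
  {M : Type*} [TopologicalSpace M] [ChartedSpace E M] [IsManifold 𝓘(ℝ, E) ∞ M]
  [RiemannianBundle (fun x : M ↦ TangentSpace 𝓘(ℝ, E) x)]
  [IsContMDiffRiemannianBundle 𝓘(ℝ, E) ∞ E (fun x : M ↦ TangentSpace 𝓘(ℝ, E) x)]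
  {F : Type*} [NormedAddCommGroup F] [NormedSpace ℝ F] [FiniteDimensional ℝ F]
  {N : Type*} [TopologicalSpace N] [ChartedSpace F N] [IsManifold 𝓘(ℝ, F) ∞ N]
  [RiemannianBundle (fun p : N ↦ TangentSpace 𝓘(ℝ, F) p)]
  [IsContMDiffRiemannianBundle 𝓘(ℝ, F) ∞ F (fun p : N ↦ TangentSpace 𝓘(ℝ, F) p)]
  {covN : CovariantDerivative 𝓘(ℝ, F) F (fun p : N ↦ TangentSpace 𝓘(ℝ, F) p)}
  {covM : CovariantDerivative 𝓘(ℝ, E) E (fun x : M ↦ TangentSpace 𝓘(ℝ, E) x)}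
  {f : M → N} {x : M}

/-- The defect is normal, so the ambient derivative is already split into its tangential and normal
parts. -/
theorem secondFundamentalForm_eq_gaussDefect (hN : IsLeviCivita covN) (hM : IsLeviCivita covM)
    (hf : ContMDiff 𝓘(ℝ, E) 𝓘(ℝ, F) ∞ f) (hg : IsInducedMetric (E := E) (F := F) f)
    (u v : TangentSpace 𝓘(ℝ, E) x) :
    secondFundamentalForm covN f x u v =
      gaussDefect covN covM f (FiberBundle.extend E v) x u := by
  rw [secondFundamentalForm,
    ← normalPart_df_add (covM (FiberBundle.extend E v) x u)
      (gaussDefect_mem_normalSpace hN hM hf hg u v), gaussDefect, add_sub_cancel]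

/-- Needed because `secondFundamentalForm` takes the direction of differentiation first, while the
formulas to be proved put the field first. -/
theorem secondFundamentalForm_symm (hN : IsLeviCivita covN) (hM : IsLeviCivita covM)
    (hf : ContMDiff 𝓘(ℝ, E) 𝓘(ℝ, F) ∞ f) (hg : IsInducedMetric (E := E) (F := F) f)
    (u v : TangentSpace 𝓘(ℝ, E) x) :
    secondFundamentalForm covN f x u v = secondFundamentalForm covN f x v u := by
  rw [secondFundamentalForm_eq_gaussDefect hN hM hf hg,
    secondFundamentalForm_eq_gaussDefect hN hM hf hg,
    gaussDefect_symm hN.torsion_free hM.torsion_free hf]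

/-- The Gauss formula. -/
theorem covAlong_df (hN : IsLeviCivita covN) (hM : IsLeviCivita covM)
    (hf : ContMDiff 𝓘(ℝ, E) 𝓘(ℝ, F) ∞ f) (hg : IsInducedMetric (E := E) (F := F) f)
    {X : (x : M) → TangentSpace 𝓘(ℝ, E) x} (hX : MDiffFieldAt X x)
    (u : TangentSpace 𝓘(ℝ, E) x) :
    covAlong covN f (fun y ↦ df f y (X y)) x u =
      df f x (covM X x u) + secondFundamentalForm covN f x (X x) u := by
  rw [secondFundamentalForm_symm hN hM hf hg,
    secondFundamentalForm_eq_gaussDefect hN hM hf hg, ← gaussDefect_eq_extend hf hX, gaussDefect,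
    add_sub_cancel]

end GaussFormula

/-! ### Linear algebra of QR-submanifolds. -/

section QR

variable {E : Type*} [NormedAddCommGroup E] [NormedSpace ℝ E]
  {M : Type*} [TopologicalSpace M] [ChartedSpace E M]
  {F : Type*} [NormedAddCommGroup F] [NormedSpace ℝ F] [FiniteDimensional ℝ F]
  {N : Type*} [TopologicalSpace N] [ChartedSpace F N] [IsManifold 𝓘(ℝ, F) ∞ N]
  [RiemannianBundle (fun p : N ↦ TangentSpace 𝓘(ℝ, F) p)]
  {covN : CovariantDerivative 𝓘(ℝ, F) F (fun p : N ↦ TangentSpace 𝓘(ℝ, F) p)}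
  {J : Fin 3 → (p : N) → TangentSpace 𝓘(ℝ, F) p →L[ℝ] TangentSpace 𝓘(ℝ, F) p}
  {f : M → N} {ν : (x : M) → Submodule ℝ (TangentSpace 𝓘(ℝ, F) (f x))} {x : M}

omit [FiniteDimensional ℝ F] [IsManifold 𝓘(ℝ, F) ∞ N]
  [RiemannianBundle fun p : N ↦ TangentSpace 𝓘(ℝ, F) p] in
theorem df_toTangent {w : TangentSpace 𝓘(ℝ, F) (f x)} (hw : w ∈ tangentImage (E := E) f x) :
    df (E := E) f x (toTangent f x w) = w :=
  Function.invFun_eq hw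

/-- An orthogonal map with square `-1` is skew. -/
theorem IsHyperKahler.inner_J_left
    [IsContMDiffRiemannianBundle 𝓘(ℝ, F) ∞ F (fun p : N ↦ TangentSpace 𝓘(ℝ, F) p)]
    (hJ : IsHyperKahler covN J) (i : Fin 3) (p : N)
    (v w : TangentSpace 𝓘(ℝ, F) p) : inner ℝ (J i p v) w = -inner ℝ v (J i p w) := by
  rw [← hJ.orthogonal i p (J i p v) w, hJ.sq, inner_neg_left]

/-- A tangent vector orthogonal to `J i n` is mapped by `J i` to a tangent vector. -/
theorem IsHypersurfaceTypeQR.J_mem_tangentImage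
    [IsContMDiffRiemannianBundle 𝓘(ℝ, F) ∞ F (fun p : N ↦ TangentSpace 𝓘(ℝ, F) p)]
    (hJ : IsHyperKahler covN J) (hf : IsHypersurfaceTypeQR (E := E) J f ν) (i : Fin 3)
    {n w : TangentSpace 𝓘(ℝ, F) (f x)} (hn : n ∈ normalCompl (E := E) f ν x) (hn0 : n ≠ 0)
    (hw : w ∈ tangentImage (E := E) f x) (hwn : inner ℝ w (J i (f x) n) = 0) :
    J i (f x) w ∈ tangentImage (E := E) f x := by
  have : FiniteDimensional ℝ (TangentSpace 𝓘(ℝ, F) (f x)) :=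
    inferInstanceAs (FiniteDimensional ℝ F)
  suffices key : J i (f x) w ∈ (tangentImage (E := E) f x)ᗮᗮ by
    rwa [Submodule.orthogonal_orthogonal] at key
  rw [Submodule.mem_orthogonal']
  intro z hz
  rw [hJ.inner_J_left, neg_eq_zero]
  -- Splitting off the `ν` part of the normal vector `z` leaves a vector of the line `ν^⊥`, hence a
  -- multiple of `n`.
  set a := (ν x).starProjection z with ha
  have haν : a ∈ ν x := Submodule.starProjection_apply_mem _ _
  have hc : z - a ∈ normalCompl (E := E) f ν x :=
    ⟨Submodule.sub_starProjection_mem_orthogonal z,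
      Submodule.sub_mem _ hz (hf.le_normal x haν)⟩
  obtain ⟨c, hc'⟩ := (finrank_eq_one_iff_of_nonzero' (⟨n, hn⟩ : normalCompl (E := E) f ν x)
    (by simpa [Subtype.ext_iff] using hn0)).1 (hf.rank_one x) ⟨z - a, hc⟩
  have hz' : z = a + c • n := by
    rw [eq_add_of_sub_eq' (congrArg Subtype.val hc').symm]
    rfl
  rw [hz', map_add, map_smul, inner_add_right, inner_smul_right, hwn, mul_zero, add_zero]
  exact Submodule.inner_right_of_mem_orthogonal hw (hf.le_normal x (hf.invariant i x a haν))

end QR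

end QRSubmanifold

end

/-! ### The two derivative formulas. -/

theorem proposition1
    {E : Type*} [NormedAddCommGroup E] [NormedSpace ℝ E] [FiniteDimensional ℝ E]
    {M : Type*} [TopologicalSpace M] [ChartedSpace E M] [IsManifold 𝓘(ℝ, E) ∞ M]
    [RiemannianBundle (fun x : M ↦ TangentSpace 𝓘(ℝ, E) x)]
    [IsContMDiffRiemannianBundle 𝓘(ℝ, E) ∞ E (fun x : M ↦ TangentSpace 𝓘(ℝ, E) x)]
    {F : Type*} [NormedAddCommGroup F] [NormedSpace ℝ F] [FiniteDimensional ℝ F]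
    {N : Type*} [TopologicalSpace N] [ChartedSpace F N] [IsManifold 𝓘(ℝ, F) ∞ N]
    [RiemannianBundle (fun p : N ↦ TangentSpace 𝓘(ℝ, F) p)]
    [IsContMDiffRiemannianBundle 𝓘(ℝ, F) ∞ F (fun p : N ↦ TangentSpace 𝓘(ℝ, F) p)]
    -- the hyper-Kähler ambient manifold with its Levi-Civita connection
    (covN : CovariantDerivative 𝓘(ℝ, F) F (fun p : N ↦ TangentSpace 𝓘(ℝ, F) p))
    (J : Fin 3 → (p : N) → TangentSpace 𝓘(ℝ, F) p →L[ℝ] TangentSpace 𝓘(ℝ, F) p)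
    (hJ : QRSubmanifold.IsHyperKahler covN J)
    -- the hypersurface type QR-submanifold
    (f : M → N) (ν : (x : M) → Submodule ℝ (TangentSpace 𝓘(ℝ, F) (f x)))
    (hf : QRSubmanifold.IsHypersurfaceTypeQR (E := E) J f ν)
    -- the induced metric and its Levi-Civita connection
    (hg : QRSubmanifold.IsInducedMetric (E := E) (F := F) f)
    (covM : CovariantDerivative 𝓘(ℝ, E) E (fun x : M ↦ TangentSpace 𝓘(ℝ, E) x))
    (hcovM : QRSubmanifold.IsLeviCivita covM)
    -- a smooth unit section of the line bundle over an open set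
    (U : Set M) (hU : IsOpen U) (n : (x : M) → TangentSpace 𝓘(ℝ, F) (f x))
    (hn_smooth : QRSubmanifold.SmoothAlongOn (E := E) f n U)
    (hn_mem : ∀ x ∈ U, n x ∈ QRSubmanifold.normalCompl (E := E) f ν x)
    (hn_unit : ∀ x ∈ U, ‖n x‖ = 1) (i : Fin 3) :
    -- `ξ i = J i n` is a smooth vector field on `U`, and the formula for its derivative
    ((∀ x ∈ U, QRSubmanifold.df f x (QRSubmanifold.xi (E := E) J f n i x) = J i (f x) (n x)) ∧
      QRSubmanifold.SmoothFieldOn (QRSubmanifold.xi (E := E) J f n i) U ∧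
      ∀ x ∈ U, ∀ u : TangentSpace 𝓘(ℝ, E) x,
        QRSubmanifold.df f x (covM (QRSubmanifold.xi J f n i) x u) =
          J i (f x) (QRSubmanifold.covAlong covN f n x u) -
            QRSubmanifold.secondFundamentalForm covN f x (QRSubmanifold.xi J f n i x) u) ∧
    -- for `X` orthogonal to `ξ i`, `J i X` is a smooth vector field on `U`, and the formula for
    -- the covariant derivative of `J i` on `X`
    (∀ X : (x : M) → TangentSpace 𝓘(ℝ, E) x, QRSubmanifold.SmoothFieldOn X U →
      (∀ x ∈ U, inner ℝ (X x) (QRSubmanifold.xi (E := E) J f n i x) = 0) →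
      (∀ x ∈ U, QRSubmanifold.df f x (QRSubmanifold.applyJ J f i X x) =
        J i (f x) (QRSubmanifold.df f x (X x))) ∧
      QRSubmanifold.SmoothFieldOn (QRSubmanifold.applyJ J f i X) U ∧
      ∀ x ∈ U, ∀ u : TangentSpace 𝓘(ℝ, E) x,
        QRSubmanifold.covDerivJ J f covM i X x u =
          J i (f x) (QRSubmanifold.secondFundamentalForm covN f x (X x) u) -
            QRSubmanifold.secondFundamentalForm covN f x
              (QRSubmanifold.applyJ J f i X x) u) := by
  have hfs : ContMDiff 𝓘(ℝ, E) 𝓘(ℝ, F) ∞ f := hf.immersion.contMDiff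
  have hinj := hg.df_injective
  have hN := hJ.leviCivita
  have hξ : ∀ x ∈ U, QRSubmanifold.df f x (QRSubmanifold.xi (E := E) J f n i x) =
      J i (f x) (n x) := fun x hx ↦
    QRSubmanifold.df_toTangent (hf.tangent i x _ (hn_mem x hx))
  have hJn : QRSubmanifold.SmoothAlongOn (E := E) f (fun y ↦ J i (f y) (n y)) U :=
    hJ.smoothAlongOn i hfs hn_smooth
  have hξs : QRSubmanifold.SmoothFieldOn (QRSubmanifold.xi (E := E) J f n i) U :=
    QRSubmanifold.smoothFieldOn_of_df hfs hinj hU (hJn.congr fun y hy ↦ by simp only [hξ y hy])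
  refine ⟨⟨hξ, hξs, fun x hx u ↦ ?_⟩, fun X hX hXξ ↦ ?_⟩
  · rw [eq_sub_iff_add_eq, ← QRSubmanifold.covAlong_df hN hcovM hfs hg (hξs.mdiffFieldAt hU hx) u,
      ← hJ.covAlong_J i (hn_smooth.mdiffAlongAt hU hx) u]
    -- `df ξ` and `J n` agree only on `U`; openness gives equality near `x`, which is all that the
    -- derivative sees.
    exact QRSubmanifold.covAlong_congr covN hfs.continuous.continuousAt
      (Filter.eventually_of_mem (hU.mem_nhds hx) hξ) u
  · have hJX : ∀ x ∈ U, QRSubmanifold.df f x (QRSubmanifold.applyJ J f i X x) =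
        J i (f x) (QRSubmanifold.df f x (X x)) := fun x hx ↦ by
      refine QRSubmanifold.df_toTangent (hf.J_mem_tangentImage hJ i (hn_mem x hx) ?_ ⟨X x, rfl⟩ ?_)
      -- The unit length is what makes `n x` a generator of the normal line.
      · intro h0
        simpa [h0] using hn_unit x hx
      · have h := hXξ x hx
        rw [hg, hξ x hx] at h
        exact h
    have hdX := hX.smoothAlongOn_df hfs
    have hJXs : QRSubmanifold.SmoothFieldOn (QRSubmanifold.applyJ J f i X) U :=
      QRSubmanifold.smoothFieldOn_of_df hfs hinj hU
        ((hJ.smoothAlongOn i hfs hdX).congr fun y hy ↦ by simp only [hJX y hy])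
    refine ⟨hJX, hJXs, fun x hx u ↦ ?_⟩
    -- The Gauss formula is used for `J X` in `h1` and for `X` in `h2`; parallelism of `J i` ties
    -- the two left-hand sides together.
    have h1 := QRSubmanifold.covAlong_df hN hcovM hfs hg (hJXs.mdiffFieldAt hU hx) u
    have h2 := QRSubmanifold.covAlong_df hN hcovM hfs hg (hX.mdiffFieldAt hU hx) u
    rw [QRSubmanifold.covAlong_congr covN hfs.continuous.continuousAt
      (Filter.eventually_of_mem (hU.mem_nhds hx) hJX) u,
      hJ.covAlong_J i (hdX.mdiffAlongAt hU hx) u, h2, map_add] at h1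
    rw [QRSubmanifold.covDerivJ, sub_eq_sub_iff_add_eq_add, ← h1, add_comm]
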